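/- Let $\alpha\ge 0$, let $K\ge 1$ be the number of bidders, and let $n_{k,0}\ge 0$ ($k=1,\dots,K$) be (real, deterministic) initial stakes with $N:=\sum_{k} n_{k,0}>0$. For $t\ge 1$ let $S_{k,t}$ be the event that bidder $k$ receives the reward of period $t$, and put $$n_{k,t}=n_{k,t-1}+1_{S_{k,t}},\qquad N_t=\sum_{k=1}^K n_{k,t},\qquad \mathcal F_t=\sigma(S_{k,r}:1\le k\le K,\ 1\le r\le t).$$ Assume the $\mathrm{Poly}(\alpha)$ voting rule: in each period at most one bidder receives the reward (for fixed $t$ the events $S_{k,t}$ are pairwise disjoint), and $$\mathbb P(S_{k,t+1}\mid\mathcal F_t)=\frac{n_{k,t}}{N_t^{1+\alpha}}\quad\text{a.s. for all } t\ge 0 \text{ and all } k .$$ (Such a process exists only if $N^{-\alpha}\le 1$. The volume $N_t$ increases by $1$ with conditional probability $N_t^{-\alpha}$ and otherwise stays unchanged.) For non-integer $s\ge 0$ define $N_s$ by linear interpolation of $(N_t)_{t=0,1,2,\dots}$. Then, as $n\to\infty$ along the positive integers, $$\left(\frac{N_{nu}}{n^{1/(1+\alpha)}},\ u\ge 0\right)\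 \stackrel{d}{\longrightarrow}\ (X_u,\ u\ge 0)\quad\text{in } C[0,\infty),$$ where $C[0,\infty)$ has the topology of uniform convergence on compact sets and the limit is the deterministic path $$X_u=\big((1+\alpha)u\big)^{1/(1+\alpha)},\qquad u\ge 0 .$$ Moreover, $X$ is the solution of $dX_u=X_u^{-\alpha}\,du$ with $X_0=0$: it is the unique continuous function on $[0,\infty)$ with $X_0=0$ that is positive on $(0,\infty)$, is differentiable there, and satisfies $X_u'=X_u^{-\alpha}$ for all $u>0$. -/

import Mathlib

open MeasureTheory ProbabilityTheory Filter Topology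
open scoped NNReal

noncomputable section

namespace PolyVoting

variable {Ω : Type*} {K : ℕ}

/-- The number `n_{k,t}` of stakes of bidder `k` at time `t`: bidder `k` starts with `n₀ k` stakes
and gains one stake in period `t ≥ 1` exactly on the event `S k t` (`S k 0` is never used). -/
def stake (n₀ : Fin K → ℝ) (S : Fin K → ℕ → Set Ω) (k : Fin K) : ℕ → Ω → ℝ
  | 0, _ => n₀ k
  | t + 1, ω => stake n₀ S k t ω + (S k (t + 1)).indicator (fun _ => (1 : ℝ)) ω

/-- The total volume `N_t = ∑ k, n_{k,t}` of stakes at time `t`. -/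
def totalStake (n₀ : Fin K → ℝ) (S : Fin K → ℕ → Set Ω) (t : ℕ) (ω : Ω) : ℝ :=
  ∑ k, stake n₀ S k t ω

/-- The voting power `θ_{k,t} = n_{k,t} / N_t ^ (1 + α)` of bidder `k` at time `t`. -/
def power (α : ℝ) (n₀ : Fin K → ℝ) (S : Fin K → ℕ → Set Ω) (k : Fin K) (t : ℕ) (ω : Ω) : ℝ :=
  stake n₀ S k t ω / totalStake n₀ S t ω ^ (1 + α)

/-- The σ-algebra `ℱ_t` generated by the events `S k r`, over all bidders `k` and all periods
`1 ≤ r ≤ t`. -/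
@[reducible]
def history (S : Fin K → ℕ → Set Ω) (t : ℕ) : MeasurableSpace Ω :=
  MeasurableSpace.generateFrom {A | ∃ k r, 1 ≤ r ∧ r ≤ t ∧ A = S k r}

/-- The `Poly(α)` voting rule with initial stakes `n₀`: `S k t` is the event that bidder `k`
receives the reward of period `t ≥ 1`. In each period at most one bidder receives the (single)
reward, and, given the past, bidder `k` receives it with probability equal to its current
voting power. -/
structure IsPolyVoting [MeasurableSpace Ω] (μ : Measure Ω) (α : ℝ) (n₀ : Fin K → ℝ)
    (S : Fin K → ℕ → Set Ω) : Prop where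
  measurableSet : ∀ k t, 1 ≤ t → MeasurableSet (S k t)
  disjoint : ∀ t, 1 ≤ t → ∀ j k, j ≠ k → Disjoint (S j t) (S k t)
  condProb : ∀ k t,
    μ[(S k (t + 1)).indicator (fun _ => (1 : ℝ)) | history S t] =ᵐ[μ] power α n₀ S k t

/-- Linear interpolation of a sequence `x 0, x 1, …` to real times `s ≥ 0`. -/
def interp (x : ℕ → ℝ) (s : ℝ) : ℝ :=
  x ⌊s⌋₊ + (s - ⌊s⌋₊) * (x (⌊s⌋₊ + 1) - x ⌊s⌋₊)

theorem interp_eq_of_mem (x : ℕ → ℝ) (m : ℕ) {s : ℝ} (h : s ∈ Set.Icc (m : ℝ) (m + 1)) :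
    interp x s = x m + (s - m) * (x (m + 1) - x m) := by
  rcases h.2.lt_or_eq with h2 | h2
  · have : ⌊s⌋₊ = m := (Nat.floor_eq_iff (le_trans (Nat.cast_nonneg m) h.1)).2 ⟨h.1, h2⟩
    rw [interp, this]
  · have : ⌊s⌋₊ = m + 1 := by
      rw [h2]; exact_mod_cast Nat.floor_natCast (R := ℝ) (m + 1)
    rw [interp, this, h2]; push_cast; ring

theorem continuous_interp (x : ℕ → ℝ) : Continuous fun u : ℝ≥0 => interp x u := by
  have hlf : LocallyFinite fun m : ℕ => {u : ℝ≥0 | (u : ℝ) ∈ Set.Icc (m : ℝ) (m + 1)} := by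
    intro u
    refine ⟨Set.Iio (u + 1), Iio_mem_nhds (by simp), ?_⟩
    refine (Set.finite_Iic ⌈(u : ℝ) + 1⌉₊).subset ?_
    rintro m ⟨v, hv1, hv2⟩
    have h1 : (v : ℝ) < u + 1 := by exact_mod_cast hv2
    have h2 : (m : ℝ) ≤ v := hv1.1
    have h3 := Nat.le_ceil ((u : ℝ) + 1)
    have : (m : ℝ) ≤ (⌈(u : ℝ) + 1⌉₊ : ℝ) := by linarith
    exact Set.mem_Iic.2 (by exact_mod_cast this)
  refine hlf.continuous ?_ (fun m => isClosed_Icc.preimage NNReal.continuous_coe) fun m => ?_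
  · refine Set.eq_univ_of_forall fun u => Set.mem_iUnion.2 ⟨⌊(u : ℝ)⌋₊, ?_⟩
    exact ⟨Nat.floor_le u.2, (Nat.lt_floor_add_one _).le⟩
  · have : Continuous fun u : ℝ≥0 => x m + ((u : ℝ) - m) * (x (m + 1) - x m) := by fun_prop
    exact this.continuousOn.congr fun u hu => interp_eq_of_mem x m hu

/-- `C[0,∞)`, with the topology of uniform convergence on compact sets (the compact-open topology
of Mathlib), carries its Borel σ-algebra. -/
instance : MeasurableSpace C(ℝ≥0, ℝ) := borel _

instance : BorelSpace C(ℝ≥0, ℝ) := ⟨rfl⟩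

/-- The random path `u ↦ N_{nu} / n ^ (1 / (1 + α))` in `C[0,∞)`. -/
def rescaledPath (α : ℝ) (n₀ : Fin K → ℝ) (S : Fin K → ℕ → Set Ω) (n : ℕ) (ω : Ω) :
    C(ℝ≥0, ℝ) where
  toFun u := interp (fun t => totalStake n₀ S t ω) (n * u) / (n : ℝ) ^ (1 / (1 + α))
  continuous_toFun := by
    have h := (continuous_interp fun t => totalStake n₀ S t ω).comp
      (continuous_const.mul continuous_id : Continuous fun u : ℝ≥0 => (n : ℝ≥0) * u)
    simpa [Function.comp_def] using h.div_const ((n : ℝ) ^ (1 / (1 + α)))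

/-- The function `X_u = ((1 + α) u) ^ (1 / (1 + α))`. -/
def fluid (α : ℝ) (u : ℝ) : ℝ := ((1 + α) * u) ^ (1 / (1 + α))

/-- The function `fluid α` on `u ≥ 0`, as an element of `C[0,∞)`. -/
def fluidPath (α : ℝ) (hα : 0 ≤ α) : C(ℝ≥0, ℝ) where
  toFun u := fluid α u
  continuous_toFun := by
    have h : (0 : ℝ) ≤ 1 / (1 + α) := by positivity
    unfold fluid
    exact (continuous_const.mul NNReal.continuous_coe).rpow_const fun _ => Or.inr h

/-- `Y` (restricted to `u ≥ 0`) is a solution of `dY = Y ^ (-α) du`, `Y 0 = 0`: it is continuous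
on `[0, ∞)`, vanishes at `0`, and for `u > 0` it is positive (so that `Y ^ (-α)` makes sense) and
satisfies the equation. -/
structure IsFluidSolution (α : ℝ) (Y : ℝ → ℝ) : Prop where
  zero : Y 0 = 0
  continuousOn : ContinuousOn Y (Set.Ici 0)
  pos : ∀ u, 0 < u → 0 < Y u
  hasDerivAt : ∀ u, 0 < u → HasDerivAt Y (Y u ^ (-α)) u

end PolyVoting

end

/-!
Write `N_t` for the total stake. Summing the voting powers over the bidders, `N_t` increases by one
with conditional probability `N_t ^ (-α)`. Hence the *clock* `∑ s < t, (N_{s+1} - N_s) * N_s ^ α`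
has conditional drift exactly one, and `clock t - t` is a martingale, whose increments have
conditional second moment `N_t ^ α - 1` (`IsPolyVoting.integral_clock_sub_sq_succ`).

On the other hand the clock is a Riemann sum for `∫ x ^ α dx` over the range of `N`, so it is
comparable to `N_t ^ (1 + α) / (1 + α)` outcome by outcome. This bounds `E[N_t ^ α]` by a multiple
of `t ^ (α / (1 + α))`, and the second moment of `clock t - t` by a multiple of
`t ^ (1 + α / (1 + α))`, which is smaller than `t ^ 2` by a power of `t`. Summing along polynomial
times and using monotonicity of the clock, `clock t / t → 1` almost surely
(`IsPolyVoting.ae_tendsto_clock_div`). The comparison then gives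
`N_t / t ^ (1 / (1 + α)) → (1 + α) ^ (1 / (1 + α))` almost surely
(`IsUnitStep.tendsto_div_rpow`).

The rest is deterministic: such a power law at integer times forces locally uniform convergence of
the rescaled interpolated paths (`tendsto_rescaledPath`). The paths therefore converge almost surely
in `C[0,∞)`, which is stronger than convergence in distribution. The fluid equation is solved by
observing that `Y ^ (1 + α)` has constant derivative `1 + α` (`IsFluidSolution.eq_fluid`).
-/

noncomputable section

namespace PolyVoting

/-! ### Power increments and the clock of a counting sequence -/

/-- Mean value theorem for `y ↦ y ^ (1 + α)` on `[x, x + 1]`. -/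
theorem mul_rpow_le_rpow_add_one_sub {α x : ℝ} (hα : 0 ≤ α) (hx : 0 < x) :
    (1 + α) * x ^ α ≤ (x + 1) ^ (1 + α) - x ^ (1 + α) ∧
      (x + 1) ^ (1 + α) - x ^ (1 + α) ≤ (1 + α) * (x + 1) ^ α := by
  obtain ⟨c, hc, h⟩ := exists_hasDerivAt_eq_slope (fun y : ℝ => y ^ (1 + α))
    (fun y => (1 + α) * y ^ α) (by linarith : x < x + 1)
    (fun y _ => (Real.continuousAt_rpow_const y _ (Or.inr (by positivity))).continuousWithinAt)
    (fun y hy => by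
      simpa using Real.hasDerivAt_rpow_const (x := y) (p := 1 + α) (Or.inl (hx.trans hy.1).ne'))
  have h' : (x + 1) ^ (1 + α) - x ^ (1 + α) = (1 + α) * c ^ α := by rw [h]; simp
  rw [h']
  have hxc := hc.1.le
  have hcx := hc.2.le
  have hc0 : 0 < c := hx.trans hc.1
  constructor <;> gcongr

/-- The additive functional `∑ s < t, (N (s + 1) - N s) * N s ^ α` of a sequence `N`. Along the
total stake of the `Poly(α)` rule it runs at unit speed on average, since a unit step from `N s`
occurs with conditional probability `N s ^ (-α)`. -/
def clock (α : ℝ) (N : ℕ → ℝ) (t : ℕ) : ℝ :=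
  ∑ s ∈ Finset.range t, (N (s + 1) - N s) * N s ^ α

theorem clock_succ (α : ℝ) (N : ℕ → ℝ) (t : ℕ) :
    clock α N (t + 1) = clock α N t + (N (t + 1) - N t) * N t ^ α :=
  Finset.sum_range_succ _ t

/-- A sequence that starts from a positive value and, in each step, stays or increases by one. -/
structure IsUnitStep (N : ℕ → ℝ) : Prop where
  pos_zero : 0 < N 0
  step : ∀ t, N (t + 1) = N t ∨ N (t + 1) = N t + 1

namespace IsUnitStep

variable {N : ℕ → ℝ} {α : ℝ}

theorem monotone (h : IsUnitStep N) : Monotone N :=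
  monotone_nat_of_le_succ fun t => by rcases h.step t with h | h <;> linarith

theorem pos (h : IsUnitStep N) (t : ℕ) : 0 < N t :=
  h.pos_zero.trans_le (h.monotone (Nat.zero_le t))

theorem sub_mem (h : IsUnitStep N) (t : ℕ) : N (t + 1) - N t ∈ Set.Icc (0 : ℝ) 1 := by
  rcases h.step t with h | h <;> simp [h]

theorem le_add (h : IsUnitStep N) (t : ℕ) : N t ≤ N 0 + t := by
  induction t with
  | zero => simp
  | succ t ih => have := (h.sub_mem t).2; push_cast; linarith

theorem monotone_clock (h : IsUnitStep N) : Monotone (clock α N) :=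
  monotone_nat_of_le_succ fun t => by
    rw [clock_succ]
    have := mul_nonneg (h.sub_mem t).1 (Real.rpow_nonneg (h.pos t).le α)
    linarith

theorem clock_nonneg (h : IsUnitStep N) (t : ℕ) : 0 ≤ clock α N t :=
  Finset.sum_nonneg fun s _ => mul_nonneg (h.sub_mem s).1 (Real.rpow_nonneg (h.pos s).le α)

theorem mul_clock_le (h : IsUnitStep N) (hα : 0 ≤ α) (t : ℕ) :
    (1 + α) * clock α N t ≤ N t ^ (1 + α) := by
  induction t with
  | zero => simpa [clock] using Real.rpow_nonneg h.pos_zero.le _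
  | succ t ih =>
    have hx := (mul_rpow_le_rpow_add_one_sub hα (h.pos t)).1
    rw [clock_succ]
    rcases h.step t with h | h <;> simp only [h, sub_self, add_sub_cancel_left] <;> linarith

/-- The upper bound telescopes because `(x + 1) ^ (1 + α) - x ^ (1 + α)` exceeds `(1 + α) * x ^ α`
by at most the increment of `(1 + α) * x ^ α`. -/
theorem rpow_le_mul_clock_add (h : IsUnitStep N) (hα : 0 ≤ α) (t : ℕ) :
    N t ^ (1 + α) ≤ (1 + α) * clock α N t + (1 + α) * N t ^ α + N 0 ^ (1 + α) := by
  induction t with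
  | zero => simpa [clock] using mul_nonneg (by positivity) (Real.rpow_nonneg h.pos_zero.le α)
  | succ t ih =>
    have hx := (mul_rpow_le_rpow_add_one_sub hα (h.pos t)).2
    rw [clock_succ]
    rcases h.step t with h | h <;> simp only [h, sub_self, add_sub_cancel_left] <;> linarith

/-- A one-sided comparison without error term in `N t`, from `N s + 1 ≤ ((N 0 + 1) / N 0) * N s`. It
bounds moments of `N t` by those of the clock. -/
theorem rpow_le_const_mul_clock (h : IsUnitStep N) (hα : 0 ≤ α) (t : ℕ) :
    N t ^ (1 + α) ≤ N 0 ^ (1 + α) + (1 + α) * ((N 0 + 1) / N 0) ^ α * clock α N t := by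
  induction t with
  | zero => simp [clock]
  | succ t ih =>
    have h0 := h.pos_zero
    have ht := h.pos t
    have hx := (mul_rpow_le_rpow_add_one_sub hα ht).2
    have hle : (N t + 1) ^ α ≤ ((N 0 + 1) / N 0) ^ α * N t ^ α := by
      rw [← Real.mul_rpow (by positivity) ht.le]
      refine Real.rpow_le_rpow (by positivity) ?_ hα
      rw [div_mul_eq_mul_div, le_div_iff₀ h0]
      linarith [h.monotone (Nat.zero_le t)]
    have hle' := mul_le_mul_of_nonneg_left hle (by positivity : 0 ≤ 1 + α)
    rw [clock_succ]
    rcases h.step t with h | h <;> simp only [h, sub_self, add_sub_cancel_left] <;> linarith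

/-- Since `N t ^ α = o(N t ^ (1 + α))`, the two comparisons of `N t ^ (1 + α)` with `(1 + α) * clock t`
give `N t ^ (1 + α) ∼ (1 + α) * t`. -/
theorem tendsto_div_rpow (h : IsUnitStep N) (hα : 0 ≤ α)
    (hc : Tendsto (fun t : ℕ => clock α N t / t) atTop (𝓝 1)) :
    Tendsto (fun t : ℕ => N t / (t : ℝ) ^ (1 / (1 + α))) atTop
      (𝓝 ((1 + α) ^ (1 / (1 + α)))) := by
  have hp : 0 < 1 + α := by linarith
  have hclock : Tendsto (clock α N) atTop atTop := by
    refine (hc.pos_mul_atTop one_pos tendsto_natCast_atTop_atTop).congr' ?_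
    filter_upwards [eventually_gt_atTop 0] with t ht
    have : (t : ℝ) ≠ 0 := by positivity
    field_simp
  have hNp : Tendsto (fun t => N t ^ (1 + α)) atTop atTop :=
    tendsto_atTop_mono (h.mul_clock_le hα) (hclock.const_mul_atTop hp)
  have hNtop : Tendsto N atTop atTop := by
    refine ((tendsto_rpow_atTop (inv_pos.2 hp)).comp hNp).congr fun t => ?_
    exact Real.rpow_rpow_inv (h.pos t).le hp.ne'
  have hlow : Tendsto (fun t : ℕ => (1 + α) * (clock α N t / t)) atTop (𝓝 (1 + α)) := by
    simpa using hc.const_mul (1 + α)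
  have hup : Tendsto (fun t : ℕ => ((1 + α) * (clock α N t / t) + N 0 ^ (1 + α) / t) /
      (1 - (1 + α) / N t)) atTop (𝓝 (1 + α)) := by
    simpa [Pi.div_def] using (hlow.add (tendsto_const_nhds.div_atTop tendsto_natCast_atTop_atTop)).div
      ((tendsto_const_nhds (x := (1 : ℝ))).sub (tendsto_const_nhds.div_atTop hNtop)) (by simp)
  have hlim : Tendsto (fun t : ℕ => N t ^ (1 + α) / t) atTop (𝓝 (1 + α)) := by
    refine tendsto_of_tendsto_of_tendsto_of_le_of_le' hlow hup ?_ ?_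
    · refine Eventually.of_forall fun t => ?_
      rw [← mul_div_assoc]
      exact div_le_div_of_nonneg_right (h.mul_clock_le hα t) t.cast_nonneg
    · filter_upwards [eventually_gt_atTop 0, hNtop.eventually_gt_atTop (1 + α)] with t ht hNt
      have ht' : (0 : ℝ) < t := by exact_mod_cast ht
      have hN := h.pos t
      have h1 : 0 < 1 - (1 + α) / N t := by
        rw [sub_pos, div_lt_one hN]; exact hNt
      rw [le_div_iff₀ h1, div_mul_eq_mul_div, ← mul_div_assoc, ← add_div]
      refine div_le_div_of_nonneg_right ?_ ht'.le
      have h2 : N t ^ (1 + α) = N t * N t ^ α := by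
        rw [Real.rpow_add hN, Real.rpow_one]
      have h3 : N t ^ (1 + α) * (1 - (1 + α) / N t) = N t ^ (1 + α) - (1 + α) * N t ^ α := by
        rw [h2]; field_simp
      linarith [h.rpow_le_mul_clock_add hα t]
  refine (hlim.rpow_const (p := 1 / (1 + α)) (Or.inl hp.ne')).congr fun t => ?_
  rw [Real.div_rpow (Real.rpow_nonneg (h.pos t).le _) t.cast_nonneg, one_div,
    Real.rpow_rpow_inv (h.pos t).le hp.ne']

end IsUnitStep

/-! ### Locally uniform convergence of interpolated paths -/

/-- A sublinear power law for `N` carries over to all real times with an error that is a small multiple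
of the power plus a constant. The constant absorbs the finitely many early times and the
interpolation error; it disappears in the scaling limit. -/
theorem IsUnitStep.abs_interp_sub_le {N : ℕ → ℝ} (h : IsUnitStep N) {c β ε : ℝ} (hc : 0 ≤ c)
    (hβ : 0 < β) (hβ1 : β ≤ 1) (hε : 0 < ε)
    (hN : Tendsto (fun t : ℕ => N t / (t : ℝ) ^ β) atTop (𝓝 c)) :
    ∃ B, ∀ s : ℝ, 0 ≤ s → |interp N s - c * s ^ β| ≤ ε * s ^ β + B := by
  have hev : ∀ᶠ t : ℕ in atTop, |N t - c * (t : ℝ) ^ β| ≤ ε * (t : ℝ) ^ β := by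
    filter_upwards [(Metric.tendsto_nhds.1 hN) ε hε, eventually_gt_atTop 0] with t ht ht0
    have ht' : (0 : ℝ) < (t : ℝ) ^ β := Real.rpow_pos_of_pos (by exact_mod_cast ht0) _
    rw [Real.dist_eq] at ht
    have : N t - c * (t : ℝ) ^ β = (N t / (t : ℝ) ^ β - c) * (t : ℝ) ^ β := by field_simp
    rw [this, abs_mul, abs_of_pos ht']
    gcongr
  obtain ⟨T, hT⟩ := eventually_atTop.1 hev
  have hall : ∀ t : ℕ, |N t - c * (t : ℝ) ^ β| ≤
      ε * (t : ℝ) ^ β + ∑ r ∈ Finset.range T, |N r - c * (r : ℝ) ^ β| := by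
    intro t
    have hnn : 0 ≤ ε * (t : ℝ) ^ β := by positivity
    rcases lt_or_ge t T with htT | htT
    · have := Finset.single_le_sum (f := fun r : ℕ => |N r - c * (r : ℝ) ^ β|)
        (fun _ _ => abs_nonneg _) (Finset.mem_range.2 htT)
      linarith
    · have : 0 ≤ ∑ r ∈ Finset.range T, |N r - c * (r : ℝ) ^ β| :=
        Finset.sum_nonneg fun _ _ => abs_nonneg _
      linarith [hT t htT]
  refine ⟨∑ r ∈ Finset.range T, |N r - c * (r : ℝ) ^ β| + 1 + c, fun s hs => ?_⟩
  set t := ⌊s⌋₊ with ht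
  have h1 : (t : ℝ) ≤ s := Nat.floor_le hs
  have h2 : s < t + 1 := Nat.lt_floor_add_one s
  have h3 : (t : ℝ) ^ β ≤ s ^ β := Real.rpow_le_rpow t.cast_nonneg h1 hβ.le
  have h4 : s ^ β ≤ (t : ℝ) ^ β + 1 := by
    calc s ^ β ≤ ((t : ℝ) + 1) ^ β := Real.rpow_le_rpow hs h2.le hβ.le
      _ ≤ (t : ℝ) ^ β + 1 ^ β := Real.rpow_add_le_add_rpow t.cast_nonneg zero_le_one hβ.le hβ1
      _ = _ := by simp
  have h5 : |interp N s - N t| ≤ 1 := by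
    have h6 := h.sub_mem t
    have : interp N s - N t = (s - t) * (N (t + 1) - N t) := by rw [interp]; ring
    rw [this, abs_of_nonneg (mul_nonneg (by linarith) h6.1)]
    exact mul_le_one₀ (by linarith) h6.1 h6.2
  have h7 : |c * (t : ℝ) ^ β - c * s ^ β| ≤ c := by
    rw [← mul_sub, abs_mul, abs_of_nonneg hc, abs_sub_comm, abs_of_nonneg (by linarith)]
    nlinarith
  have h8 := mul_le_mul_of_nonneg_left h3 hε.le
  calc |interp N s - c * s ^ β|
      = |(interp N s - N t) + (N t - c * (t : ℝ) ^ β) + (c * (t : ℝ) ^ β - c * s ^ β)| := by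
        congr 1; ring
    _ ≤ |interp N s - N t| + |N t - c * (t : ℝ) ^ β| + |c * (t : ℝ) ^ β - c * s ^ β| :=
        abs_add_three _ _ _
    _ ≤ _ := by linarith [hall t]

/-- Along every outcome with `N_t / t ^ (1 / (1 + α)) → (1 + α) ^ (1 / (1 + α))`, the rescaled path
converges to the fluid path in `C[0,∞)`. -/
theorem tendsto_rescaledPath {Ω : Type*} {K : ℕ} {α : ℝ} (hα : 0 ≤ α) {n₀ : Fin K → ℝ}
    {S : Fin K → ℕ → Set Ω} {ω : Ω} (h : IsUnitStep fun t => totalStake n₀ S t ω)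
    (hN : Tendsto (fun t : ℕ => totalStake n₀ S t ω / (t : ℝ) ^ (1 / (1 + α))) atTop
      (𝓝 ((1 + α) ^ (1 / (1 + α))))) :
    Tendsto (fun n => rescaledPath α n₀ S n ω) atTop (𝓝 (fluidPath α hα)) := by
  have hp : 0 < 1 + α := by linarith
  have hβ : 0 < 1 / (1 + α) := by positivity
  have hβ1 : 1 / (1 + α) ≤ 1 := by rw [div_le_one hp]; linarith
  rw [ContinuousMap.tendsto_iff_forall_isCompact_tendstoUniformlyOn]
  intro A hA
  rw [Metric.tendstoUniformlyOn_iff]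
  intro δ hδ
  obtain ⟨T, hT⟩ := hA.bddAbove
  set β := 1 / (1 + α) with hβdef
  have hTβ : 0 ≤ (T : ℝ) ^ β := by positivity
  obtain ⟨B, hB⟩ := h.abs_interp_sub_le (ε := δ / (2 * ((T : ℝ) ^ β + 1)))
    (Real.rpow_nonneg hp.le β) hβ hβ1 (by positivity) hN
  have hn : Tendsto (fun n : ℕ => B / (n : ℝ) ^ β) atTop (𝓝 0) :=
    tendsto_const_nhds.div_atTop ((tendsto_rpow_atTop hβ).comp tendsto_natCast_atTop_atTop)
  filter_upwards [hn.eventually_lt_const (half_pos hδ), eventually_gt_atTop 0] with n hnB hn0 u hu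
  have hn' : (0 : ℝ) < (n : ℝ) ^ β := Real.rpow_pos_of_pos (by exact_mod_cast hn0) _
  have huT : (u : ℝ) ^ β ≤ (T : ℝ) ^ β :=
    Real.rpow_le_rpow u.2 (NNReal.coe_le_coe.2 (hT hu)) hβ.le
  have hb := hB (n * u) (by positivity)
  rw [Real.mul_rpow n.cast_nonneg u.coe_nonneg] at hb
  have hval : rescaledPath α n₀ S n ω u - fluidPath α hα u =
      (interp (fun t => totalStake n₀ S t ω) (n * u) - (1 + α) ^ β * ((n : ℝ) ^ β * (u : ℝ) ^ β)) /
        (n : ℝ) ^ β := by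
    have h1 : rescaledPath α n₀ S n ω u =
      interp (fun t => totalStake n₀ S t ω) (n * u) / (n : ℝ) ^ β := rfl
    have h2 : fluidPath α hα u = ((1 + α) * (u : ℝ)) ^ β := rfl
    rw [h1, h2, Real.mul_rpow hp.le u.coe_nonneg]
    field_simp
  rw [dist_comm, Real.dist_eq, hval, abs_div, abs_of_pos hn']
  have hfrac : δ / (2 * ((T : ℝ) ^ β + 1)) * (u : ℝ) ^ β ≤ δ / 2 := by
    rw [div_mul_eq_mul_div, div_le_div_iff₀ (by positivity) two_pos]
    nlinarith
  calc _ ≤ (δ / (2 * ((T : ℝ) ^ β + 1)) * ((n : ℝ) ^ β * (u : ℝ) ^ β) + B) / (n : ℝ) ^ β := by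
        gcongr
    _ = δ / (2 * ((T : ℝ) ^ β + 1)) * (u : ℝ) ^ β + B / (n : ℝ) ^ β := by field_simp
    _ < δ := by linarith

/-! ### The fluid equation -/

theorem isFluidSolution_fluid {α : ℝ} (hα : 0 ≤ α) : IsFluidSolution α (fluid α) := by
  have hp : 0 < 1 + α := by linarith
  refine ⟨?_, ?_, fun u hu => ?_, fun u hu => ?_⟩
  · simp [fluid, Real.zero_rpow (inv_pos.2 hp).ne']
  · unfold fluid
    exact ((continuous_const.mul continuous_id).rpow_const
      fun _ => Or.inr (by positivity)).continuousOn
  · unfold fluid; positivity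
  · have hu' : 0 < (1 + α) * u := by positivity
    have h := ((hasDerivAt_id u).const_mul (1 + α)).rpow_const (p := 1 / (1 + α)) (Or.inl hu'.ne')
    have hexp : 1 / (1 + α) - 1 = 1 / (1 + α) * -α := by field_simp; ring
    refine HasDerivAt.congr_deriv h ?_
    rw [hexp, fluid, ← Real.rpow_mul hu'.le]
    simp only [id]
    field_simp

/-- If `Y' = Y ^ (-α)` on `(0, ∞)`, then `Y ^ (1 + α)` has constant derivative `1 + α` there. -/
theorem IsFluidSolution.eq_fluid {α : ℝ} (hα : 0 ≤ α) {Y : ℝ → ℝ} (hY : IsFluidSolution α Y)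
    {u : ℝ} (hu : 0 ≤ u) : Y u = fluid α u := by
  have hp : 0 < 1 + α := by linarith
  rcases hu.eq_or_lt with rfl | hu
  · rw [hY.zero, (isFluidSolution_fluid hα).zero]
  obtain ⟨c, hc, h⟩ := exists_hasDerivAt_eq_slope (fun y => Y y ^ (1 + α)) (fun _ => 1 + α) hu
    ((hY.continuousOn.mono Set.Icc_subset_Ici_self).rpow_const fun _ _ => Or.inr hp.le)
    (fun y hy => by
      have hpos := hY.pos y hy.1
      convert (hY.hasDerivAt y hy.1).rpow_const (p := 1 + α) (Or.inl hpos.ne') using 1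
      rw [add_sub_cancel_left, mul_right_comm, ← Real.rpow_add hpos]
      simp)
  rw [hY.zero, Real.zero_rpow hp.ne', sub_zero, sub_zero, eq_div_iff hu.ne'] at h
  rw [fluid, h, one_div, Real.rpow_rpow_inv (hY.pos u hu).le hp.ne']

variable {Ω : Type*} {K : ℕ}

/-! ### The total stake of the voting process -/

theorem totalStake_succ (n₀ : Fin K → ℝ) (S : Fin K → ℕ → Set Ω) (t : ℕ) (ω : Ω) :
    totalStake n₀ S (t + 1) ω =
      totalStake n₀ S t ω + ∑ k, (S k (t + 1)).indicator (fun _ => (1 : ℝ)) ω := by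
  simp [totalStake, stake, Finset.sum_add_distrib]

theorem isUnitStep_totalStake {n₀ : Fin K → ℝ} (hN : 0 < ∑ k, n₀ k) {S : Fin K → ℕ → Set Ω}
    (hS : ∀ t, 1 ≤ t → ∀ j k, j ≠ k → Disjoint (S j t) (S k t)) (ω : Ω) :
    IsUnitStep fun t => totalStake n₀ S t ω := by
  refine ⟨by simpa [totalStake, stake] using hN, fun t => ?_⟩
  simp only [totalStake_succ]
  by_cases h : ∃ j, ω ∈ S j (t + 1)
  · obtain ⟨j, hj⟩ := h
    right
    rw [Finset.sum_eq_single j, Set.indicator_of_mem hj]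
    · intro k _ hk
      exact Set.indicator_of_notMem
        (fun hk' => Set.disjoint_left.1 (hS (t + 1) (by omega) k j hk) hk' hj) _
    · simp
  · left
    push Not at h
    simp [Set.indicator_of_notMem (h _)]

theorem history_mono (S : Fin K → ℕ → Set Ω) {s t : ℕ} (hst : s ≤ t) :
    history S s ≤ history S t :=
  MeasurableSpace.generateFrom_mono fun _ ⟨k, r, h1, hr, hA⟩ => ⟨k, r, h1, hr.trans hst, hA⟩

theorem measurable_totalStake (n₀ : Fin K → ℝ) (S : Fin K → ℕ → Set Ω) (t : ℕ) :
    Measurable[history S t] (totalStake n₀ S t) := by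
  induction t with
  | zero =>
    have : totalStake n₀ S 0 = fun _ => ∑ k, n₀ k := rfl
    rw [this]
    exact measurable_const
  | succ t ih =>
    have : totalStake n₀ S (t + 1) = fun ω =>
        totalStake n₀ S t ω + ∑ k, (S k (t + 1)).indicator (fun _ => (1 : ℝ)) ω :=
      funext fun ω => totalStake_succ n₀ S t ω
    rw [this]
    refine Measurable.add (ih.mono (history_mono S t.le_succ) le_rfl)
      (Finset.measurable_fun_sum _ fun k _ => measurable_const.indicator ?_)
    exact MeasurableSpace.measurableSet_generateFrom ⟨k, t + 1, by omega, le_rfl, rfl⟩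

theorem measurable_clock (α : ℝ) (n₀ : Fin K → ℝ) (S : Fin K → ℕ → Set Ω) (t : ℕ) :
    Measurable[history S t] fun ω => clock α (fun s => totalStake n₀ S s ω) t := by
  have hm : ∀ s ≤ t, Measurable[history S t] (totalStake n₀ S s) := fun s hs =>
    (measurable_totalStake n₀ S s).mono (history_mono S hs) le_rfl
  unfold clock
  refine Finset.measurable_fun_sum _ fun s hs => ?_
  have hs' := Finset.mem_range.1 hs
  exact ((hm (s + 1) hs').sub (hm s hs'.le)).mul ((hm s hs'.le).pow_const α)

namespace IsPolyVoting

variable [MeasurableSpace Ω] {μ : Measure Ω} {α : ℝ} {n₀ : Fin K → ℝ}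
  {S : Fin K → ℕ → Set Ω}

theorem history_le (hS : IsPolyVoting μ α n₀ S) (t : ℕ) : history S t ≤ ‹MeasurableSpace Ω› :=
  MeasurableSpace.generateFrom_le fun _ ⟨k, r, h1, _, hA⟩ => hA ▸ hS.measurableSet k r h1

theorem clock_le (hS : IsPolyVoting μ α n₀ S) (hα : 0 ≤ α) (hN : 0 < ∑ k, n₀ k) (t : ℕ) (ω : Ω) :
    clock α (fun s => totalStake n₀ S s ω) t ≤ (∑ k, n₀ k + t) ^ (1 + α) := by
  have h := isUnitStep_totalStake hN hS.disjoint ω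
  have h1 := h.mul_clock_le hα t
  have h2 := h.clock_nonneg (α := α) t
  have h3 : totalStake n₀ S t ω ^ (1 + α) ≤ (∑ k, n₀ k + t) ^ (1 + α) :=
    Real.rpow_le_rpow (h.pos t).le (h.le_add t) (by positivity)
  nlinarith

theorem rpow_totalStake_le (hS : IsPolyVoting μ α n₀ S) (hα : 0 ≤ α) (hN : 0 < ∑ k, n₀ k) (t : ℕ)
    (ω : Ω) : totalStake n₀ S t ω ^ α ≤ (∑ k, n₀ k + t) ^ α := by
  have h := isUnitStep_totalStake hN hS.disjoint ω
  exact Real.rpow_le_rpow (h.pos t).le (h.le_add t) hα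

variable [IsProbabilityMeasure μ]

/-- Summing the voting powers over the bidders: the total stake `N_t` increases with conditional
probability `N_t ^ (-α)`. -/
theorem condExp_increment (hS : IsPolyVoting μ α n₀ S) (hN : 0 < ∑ k, n₀ k) (t : ℕ) :
    μ[fun ω => totalStake n₀ S (t + 1) ω - totalStake n₀ S t ω | history S t] =ᵐ[μ]
      fun ω => (totalStake n₀ S t ω ^ α)⁻¹ := by
  have heq : (fun ω => totalStake n₀ S (t + 1) ω - totalStake n₀ S t ω) =
      ∑ k, (S k (t + 1)).indicator (fun _ => (1 : ℝ)) := by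
    ext ω
    simp [totalStake_succ]
  rw [heq]
  refine (condExp_finsetSum (fun k _ => (integrable_const (1 : ℝ)).indicator
    (hS.measurableSet k (t + 1) (by omega))) _).trans ?_
  filter_upwards [ae_all_iff.2 fun k => hS.condProb k t] with ω hω
  have hpos : 0 < totalStake n₀ S t ω := (isUnitStep_totalStake hN hS.disjoint ω).pos t
  simp only [Finset.sum_apply, hω, power]
  rw [← Finset.sum_div, ← totalStake, Real.rpow_add hpos, Real.rpow_one]
  field_simp

/-- The voting rule integrated against a bounded function `Z` of the past: the increment of the total
stake may be replaced by `N_t ^ (-α)`. -/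
theorem integral_mul_increment (hS : IsPolyVoting μ α n₀ S) (hN : 0 < ∑ k, n₀ k) (t : ℕ)
    {Z : Ω → ℝ} (hZ : Measurable[history S t] Z) {b : ℝ} (hb : ∀ ω, |Z ω| ≤ b) :
    ∫ ω, Z ω * (totalStake n₀ S (t + 1) ω - totalStake n₀ S t ω) ∂μ =
      ∫ ω, Z ω * (totalStake n₀ S t ω ^ α)⁻¹ ∂μ := by
  have hle := hS.history_le t
  have hm : ∀ s, Measurable (totalStake n₀ S s) := fun s =>
    (measurable_totalStake n₀ S s).mono (hS.history_le s) le_rfl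
  have hD : Integrable (fun ω => totalStake n₀ S (t + 1) ω - totalStake n₀ S t ω) μ := by
    refine Integrable.of_bound ((hm _).sub (hm _)).aestronglyMeasurable 1 (ae_of_all _ fun ω => ?_)
    have := (isUnitStep_totalStake hN hS.disjoint ω).sub_mem t
    rw [Real.norm_of_nonneg this.1]
    exact this.2
  have h := condExp_stronglyMeasurable_mul_of_bound hle hZ.stronglyMeasurable hD b
    (ae_of_all _ hb)
  calc _ = ∫ ω, (μ[Z * fun ω => totalStake n₀ S (t + 1) ω - totalStake n₀ S t ω | history S t]) ω
          ∂μ := (integral_condExp hle).symm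
    _ = _ := by
      refine integral_congr_ae ?_
      filter_upwards [h, hS.condExp_increment hN t] with ω h1 h2
      rw [h1, Pi.mul_apply, h2]

/-! ### Moments of the clock -/

theorem integrable_clock_pow (hS : IsPolyVoting μ α n₀ S) (hα : 0 ≤ α) (hN : 0 < ∑ k, n₀ k)
    (t : ℕ) (c : ℝ) (j : ℕ) :
    Integrable (fun ω => (clock α (fun s => totalStake n₀ S s ω) t - c) ^ j) μ := by
  refine Integrable.of_bound ((((measurable_clock α n₀ S t).mono (hS.history_le t)
    le_rfl).sub_const c).pow_const j).aestronglyMeasurable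
    (((∑ k, n₀ k + t) ^ (1 + α) + |c|) ^ j) (ae_of_all _ fun ω => ?_)
  rw [norm_pow]
  refine pow_le_pow_left₀ (norm_nonneg _) ((norm_sub_le _ _).trans ?_) j
  rw [Real.norm_of_nonneg ((isUnitStep_totalStake hN hS.disjoint ω).clock_nonneg t)]
  exact add_le_add_left (hS.clock_le hα hN t ω) _

theorem integrable_rpow_totalStake (hS : IsPolyVoting μ α n₀ S) (hα : 0 ≤ α)
    (hN : 0 < ∑ k, n₀ k) (t : ℕ) : Integrable (fun ω => totalStake n₀ S t ω ^ α) μ := by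
  refine Integrable.of_bound (((measurable_totalStake n₀ S t).mono (hS.history_le t)
    le_rfl).pow_const α).aestronglyMeasurable ((∑ k, n₀ k + t) ^ α) (ae_of_all _ fun ω => ?_)
  rw [Real.norm_of_nonneg (Real.rpow_nonneg
    ((isUnitStep_totalStake hN hS.disjoint ω).pos t).le _)]
  exact hS.rpow_totalStake_le hα hN t ω

theorem integral_clock (hS : IsPolyVoting μ α n₀ S) (hα : 0 ≤ α) (hN : 0 < ∑ k, n₀ k) (t : ℕ) :
    ∫ ω, clock α (fun s => totalStake n₀ S s ω) t ∂μ = t := by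
  induction t with
  | zero => simp [clock]
  | succ t ih =>
    have hint : ∀ s, Integrable (fun ω => clock α (fun s => totalStake n₀ S s ω) s) μ :=
      fun s => by simpa using hS.integrable_clock_pow hα hN s 0 1
    have hstep : ∀ ω, clock α (fun s => totalStake n₀ S s ω) (t + 1) -
        clock α (fun s => totalStake n₀ S s ω) t =
        totalStake n₀ S t ω ^ α * (totalStake n₀ S (t + 1) ω - totalStake n₀ S t ω) := fun ω => by
      rw [clock_succ]; ring
    have h1 := hS.integral_mul_increment hN t ((measurable_totalStake n₀ S t).pow_const α)
      (b := (∑ k, n₀ k + t) ^ α) fun ω => by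
        rw [abs_of_nonneg (Real.rpow_nonneg
          ((isUnitStep_totalStake hN hS.disjoint ω).pos t).le _)]
        exact hS.rpow_totalStake_le hα hN t ω
    have h2 : ∀ ω, totalStake n₀ S t ω ^ α * (totalStake n₀ S t ω ^ α)⁻¹ = 1 := fun ω =>
      mul_inv_cancel₀ (Real.rpow_pos_of_pos
        ((isUnitStep_totalStake hN hS.disjoint ω).pos t) _).ne'
    simp_rw [h2, ← hstep] at h1
    rw [integral_sub (hint _) (hint _), ih] at h1
    simp at h1
    push_cast
    linarith

/-- The martingale `clock t - t` has orthogonal increments, with conditional second moments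
`N_t ^ α - 1`. -/
theorem integral_clock_sub_sq_succ (hS : IsPolyVoting μ α n₀ S) (hα : 0 ≤ α)
    (hN : 0 < ∑ k, n₀ k) (t : ℕ) :
    ∫ ω, (clock α (fun s => totalStake n₀ S s ω) (t + 1) - (t + 1 : ℕ)) ^ 2 ∂μ =
      ∫ ω, (clock α (fun s => totalStake n₀ S s ω) t - t) ^ 2 ∂μ +
        (∫ ω, totalStake n₀ S t ω ^ α ∂μ - 1) := by
  set G : ℕ → Ω → ℝ := fun t ω => clock α (fun s => totalStake n₀ S s ω) t with hG
  set a : Ω → ℝ := fun ω => totalStake n₀ S t ω ^ α with ha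
  set D : Ω → ℝ := fun ω => totalStake n₀ S (t + 1) ω - totalStake n₀ S t ω with hD
  have hunit := fun ω => isUnitStep_totalStake hN hS.disjoint ω
  have ha0 : ∀ ω, 0 < a ω := fun ω => Real.rpow_pos_of_pos ((hunit ω).pos t) _
  -- The part of the new square that multiplies the increment is known at time `t`.
  set Z : Ω → ℝ := fun ω => 2 * (G t ω - t) * a ω + a ω ^ 2 - 2 * a ω with hZ
  have hpt : ∀ ω, (G (t + 1) ω - (t + 1 : ℕ)) ^ 2 =
      ((G t ω - t) ^ 2 - 2 * (G t ω - t) ^ 1 + 1) + Z ω * D ω := fun ω => by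
    have hstep : G (t + 1) ω = G t ω + D ω * a ω := by
      simp only [hG, hD, ha, clock_succ]
    rw [hstep, hZ]
    push_cast
    rcases (hunit ω).step t with h | h
    · have hD0 : D ω = 0 := by simp [hD, h]
      rw [hD0]; ring
    · have hD1 : D ω = 1 := by simp [hD, h]
      rw [hD1]; ring
  have hGm : Measurable[history S t] (G t) := measurable_clock α n₀ S t
  have ham : Measurable[history S t] a := (measurable_totalStake n₀ S t).pow_const α
  have hZm : Measurable[history S t] Z :=
    ((((hGm.sub_const _).const_mul _).mul ham).add (ham.pow_const 2)).sub (ham.const_mul 2)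
  obtain ⟨b, hb⟩ : ∃ b, ∀ ω, |Z ω| ≤ b := by
    set A := (∑ k, n₀ k + t) ^ α
    set B := (∑ k, n₀ k + t) ^ (1 + α)
    refine ⟨2 * (B + t) * A + A ^ 2 + 2 * A, fun ω => ?_⟩
    have h1 : a ω ≤ A := hS.rpow_totalStake_le hα hN t ω
    have h2 : |G t ω - t| ≤ B + t := by
      have h3 : G t ω ≤ B := hS.clock_le hα hN t ω
      have h4 : 0 ≤ G t ω := (hunit ω).clock_nonneg t
      have h5 : (0 : ℝ) ≤ t := t.cast_nonneg
      rw [abs_le]; constructor <;> linarith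
    have hapos := (ha0 ω).le
    calc |Z ω| ≤ |2 * (G t ω - t) * a ω| + |a ω ^ 2| + |2 * a ω| :=
          (abs_sub _ _).trans (add_le_add_left (abs_add_le _ _) _)
      _ = 2 * |G t ω - t| * a ω + a ω ^ 2 + 2 * a ω := by
          simp [abs_mul, abs_of_nonneg hapos]
      _ ≤ _ := by gcongr
  have hkey := hS.integral_mul_increment hN t hZm hb
  have hZa : ∀ ω, Z ω * (a ω)⁻¹ = 2 * (G t ω - t) ^ 1 + a ω - 2 := fun ω => by
    have := (ha0 ω).ne'
    simp only [hZ]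
    field_simp
  have hI1 : Integrable (fun ω => 2 * (G t ω - t) ^ 1) μ :=
    (hS.integrable_clock_pow hα hN t t 1).const_mul 2
  have hI2 : Integrable (fun ω => (G t ω - t) ^ 2) μ := hS.integrable_clock_pow hα hN t t 2
  have hI2' : Integrable (fun ω => (G (t + 1) ω - (t + 1 : ℕ)) ^ 2) μ :=
    hS.integrable_clock_pow hα hN (t + 1) _ 2
  have hIa : Integrable a μ := hS.integrable_rpow_totalStake hα hN t
  have hI4 : Integrable (fun ω => 2 * (G t ω - t) ^ 1 + a ω) μ := hI1.add hIa
  have hI5 : Integrable (fun ω => (G t ω - t) ^ 2 - 2 * (G t ω - t) ^ 1) μ := hI2.sub hI1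
  have hI3 : Integrable (fun ω => (G t ω - t) ^ 2 - 2 * (G t ω - t) ^ 1 + 1) μ :=
    hI5.add (integrable_const 1)
  have hIZ : Integrable (fun ω => Z ω * D ω) μ := by
    refine (hI2'.sub hI3).congr (ae_of_all _ fun ω => ?_)
    simp only [Pi.sub_apply, hpt ω]
    ring
  have hkey' : ∫ ω, Z ω * D ω ∂μ = ∫ ω, (2 * (G t ω - t) ^ 1 + a ω - 2) ∂μ := by
    rw [hkey]
    exact integral_congr_ae (ae_of_all _ hZa)
  calc ∫ ω, (G (t + 1) ω - (t + 1 : ℕ)) ^ 2 ∂μ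
      = ∫ ω, ((G t ω - t) ^ 2 - 2 * (G t ω - t) ^ 1 + 1) ∂μ + ∫ ω, Z ω * D ω ∂μ := by
        rw [← integral_add hI3 hIZ]
        exact integral_congr_ae (ae_of_all _ hpt)
    _ = _ := by
        rw [hkey', integral_sub hI4 (integrable_const _), integral_add hI1 hIa,
          integral_add hI5 (integrable_const _), integral_sub hI2 hI1]
        simp
        ring

/-- For `θ ≤ 1` a concave power is bounded by an affine function adapted to the scale `A`. -/
theorem _root_.Real.rpow_le_rpow_add_mul {x A θ : ℝ} (hx : 0 < x) (hA : 0 < A) (hθ : 0 ≤ θ)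
    (hθ1 : θ ≤ 1) : x ^ θ ≤ A ^ θ + A ^ (θ - 1) * x := by
  rcases le_total x A with h | h
  · have := Real.rpow_le_rpow hx.le h hθ
    have : 0 ≤ A ^ (θ - 1) * x := by positivity
    linarith
  · have h1 : x ^ (θ - 1) ≤ A ^ (θ - 1) := Real.rpow_le_rpow_of_nonpos hA h (by linarith)
    have h2 : x ^ θ = x ^ (θ - 1) * x := by
      rw [Real.rpow_sub_one hx.ne']; field_simp
    have : 0 ≤ A ^ θ := by positivity
    rw [h2]
    nlinarith

/-- `N_t ^ α` is at most a multiple of `(1 + clock t) ^ (α / (1 + α))`, and the clock has mean `t`. -/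
theorem exists_integral_rpow_totalStake_le (hS : IsPolyVoting μ α n₀ S) (hα : 0 ≤ α)
    (hN : 0 < ∑ k, n₀ k) :
    ∃ C, 0 ≤ C ∧ ∀ t : ℕ, ∫ ω, totalStake n₀ S t ω ^ α ∂μ ≤ C * ((t : ℝ) + 1) ^ (α / (1 + α)) := by
  have hp : 0 < 1 + α := by linarith
  set M := ∑ k, n₀ k with hM
  set θ := α / (1 + α) with hθ
  have hθ0 : 0 ≤ θ := by positivity
  have hθ1 : θ ≤ 1 := by rw [hθ, div_le_one hp]; linarith
  set C₀ := M ^ (1 + α) + (1 + α) * ((M + 1) / M) ^ α with hC₀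
  have hC₀pos : 0 ≤ C₀ := by positivity
  refine ⟨2 * C₀ ^ θ, by positivity, fun t => ?_⟩
  set G : Ω → ℝ := fun ω => clock α (fun s => totalStake n₀ S s ω) t with hG
  have hA : (0 : ℝ) < (t : ℝ) + 1 := by positivity
  have hpt : ∀ ω, totalStake n₀ S t ω ^ α ≤
      C₀ ^ θ * (((t : ℝ) + 1) ^ θ + ((t : ℝ) + 1) ^ (θ - 1) * (1 + G ω)) := fun ω => by
    have h := isUnitStep_totalStake hN hS.disjoint ω
    have hpos : 0 < totalStake n₀ S t ω := h.pos t
    have hG0 : 0 ≤ G ω := h.clock_nonneg t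
    have h1 : totalStake n₀ S t ω ^ (1 + α) ≤ C₀ * (1 + G ω) := by
      have h2 : totalStake n₀ S t ω ^ (1 + α) ≤
        M ^ (1 + α) + (1 + α) * ((M + 1) / M) ^ α * G ω := h.rpow_le_const_mul_clock hα t
      have h3 : 0 ≤ M ^ (1 + α) * G ω := by positivity
      have h4 : 0 ≤ (1 + α) * ((M + 1) / M) ^ α := by positivity
      rw [hC₀]
      linarith
    calc totalStake n₀ S t ω ^ α = (totalStake n₀ S t ω ^ (1 + α)) ^ θ := by
          rw [← Real.rpow_mul hpos.le]; congr 1; rw [hθ]; field_simp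
      _ ≤ (C₀ * (1 + G ω)) ^ θ := Real.rpow_le_rpow (by positivity) h1 hθ0
      _ = C₀ ^ θ * (1 + G ω) ^ θ := Real.mul_rpow hC₀pos (by positivity)
      _ ≤ _ := by
        gcongr
        exact Real.rpow_le_rpow_add_mul (by positivity) hA hθ0 hθ1
  have hGi : Integrable G μ := by simpa using hS.integrable_clock_pow hα hN t 0 1
  have h1G : Integrable (fun ω => ((t : ℝ) + 1) ^ (θ - 1) * (1 + G ω)) μ :=
    ((integrable_const (1 : ℝ)).add hGi).const_mul _
  calc ∫ ω, totalStake n₀ S t ω ^ α ∂μ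
      ≤ ∫ ω, C₀ ^ θ * (((t : ℝ) + 1) ^ θ + ((t : ℝ) + 1) ^ (θ - 1) * (1 + G ω)) ∂μ :=
        integral_mono (hS.integrable_rpow_totalStake hα hN t)
          (((integrable_const _).add h1G).const_mul _) hpt
    _ = C₀ ^ θ * (((t : ℝ) + 1) ^ θ + ((t : ℝ) + 1) ^ (θ - 1) * (1 + t)) := by
        rw [integral_const_mul, integral_add (integrable_const _) h1G, integral_const_mul,
          integral_add (integrable_const _) hGi, hS.integral_clock hα hN t]
        simp
    _ = 2 * C₀ ^ θ * ((t : ℝ) + 1) ^ θ := by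
        rw [Real.rpow_sub_one hA.ne']; field_simp; ring

/-- The second moment of `clock t - t` is `O(t ^ (1 + α / (1 + α)))`, hence smaller than `t ^ 2` by the
power `t ^ (1 / (1 + α))`. -/
theorem exists_integral_clock_sub_sq_le (hS : IsPolyVoting μ α n₀ S) (hα : 0 ≤ α)
    (hN : 0 < ∑ k, n₀ k) :
    ∃ C, 0 ≤ C ∧ ∀ t : ℕ, ∫ ω, (clock α (fun s => totalStake n₀ S s ω) t - t) ^ 2 ∂μ ≤
      C * (t * (t : ℝ) ^ (α / (1 + α))) := by
  obtain ⟨C, hC, hbound⟩ := hS.exists_integral_rpow_totalStake_le hα hN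
  refine ⟨C, hC, fun t => ?_⟩
  induction t with
  | zero => simp [clock]
  | succ t ih =>
    rw [hS.integral_clock_sub_sq_succ hα hN t]
    have h1 := hbound t
    have h2 : (t : ℝ) ^ (α / (1 + α)) ≤ ((t : ℝ) + 1) ^ (α / (1 + α)) :=
      Real.rpow_le_rpow t.cast_nonneg (by linarith) (by positivity)
    have h3 := mul_le_mul_of_nonneg_left h2 (mul_nonneg hC t.cast_nonneg)
    push_cast
    linarith

end IsPolyVoting

/-! ### Almost sure convergence -/

theorem _root_.MeasureTheory.ae_tendsto_zero_of_summable_integral [MeasurableSpace Ω]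
    {μ : Measure Ω} {X : ℕ → Ω → ℝ} (hX : ∀ m, Integrable (X m) μ) (h0 : ∀ m ω, 0 ≤ X m ω)
    (hs : Summable fun m => ∫ ω, X m ω ∂μ) :
    ∀ᵐ ω ∂μ, Tendsto (fun m => X m ω) atTop (𝓝 0) := by
  have hmeas : ∀ m, AEMeasurable (fun ω => ENNReal.ofReal (X m ω)) μ := fun m =>
    (hX m).aestronglyMeasurable.aemeasurable.ennreal_ofReal
  have hfin : ∫⁻ ω, ∑' m, ENNReal.ofReal (X m ω) ∂μ ≠ ⊤ := by
    rw [lintegral_tsum hmeas]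
    have heq : ∀ m, ∫⁻ ω, ENNReal.ofReal (X m ω) ∂μ = ENNReal.ofReal (∫ ω, X m ω ∂μ) := fun m =>
      (ofReal_integral_eq_lintegral_ofReal (hX m) (ae_of_all _ (h0 m))).symm
    simp_rw [heq]
    exact hs.tsum_ofReal_ne_top
  filter_upwards [ae_lt_top' (AEMeasurable.tsum hmeas) hfin] with ω hω
  have h1 := (ENNReal.tendsto_toReal ENNReal.zero_ne_top).comp
    (ENNReal.tendsto_atTop_zero_of_tsum_ne_top hω.ne)
  refine h1.congr fun m => ?_
  simp [h0 m ω]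

/-- The averages of the clock converge almost surely along the polynomial times `(m + 1) ^ q`, `q`
large, where the second moments are summable; monotonicity fills the gaps between them. -/
theorem IsPolyVoting.ae_tendsto_clock_div [MeasurableSpace Ω] {μ : Measure Ω}
    [IsProbabilityMeasure μ] {α : ℝ} {n₀ : Fin K → ℝ} {S : Fin K → ℕ → Set Ω}
    (hS : IsPolyVoting μ α n₀ S) (hα : 0 ≤ α) (hN : 0 < ∑ k, n₀ k) :
    ∀ᵐ ω ∂μ, Tendsto (fun t : ℕ => clock α (fun s => totalStake n₀ S s ω) t / t) atTop (𝓝 1) := by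
  have hp : 0 < 1 + α := by linarith
  obtain ⟨C, hC, hvar⟩ := hS.exists_integral_clock_sub_sq_le hα hN
  set q := ⌈2 * (1 + α)⌉₊ with hq
  have hq2 : 2 * (1 + α) ≤ q := Nat.le_ceil _
  have hq0 : q ≠ 0 := by
    intro h
    rw [h] at hq2
    simp at hq2
    linarith
  set c : ℕ → ℕ := fun m => (m + 1) ^ q with hc
  have hcpos : ∀ m, (0 : ℝ) < c m := fun m => by simp only [hc]; positivity
  have hsq : ∀ᵐ ω ∂μ, Tendsto (fun m =>
      (clock α (fun s => totalStake n₀ S s ω) (c m) - c m) ^ 2 / (c m : ℝ) ^ 2) atTop (𝓝 0) := by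
    refine ae_tendsto_zero_of_summable_integral
      (fun m => (hS.integrable_clock_pow hα hN (c m) (c m) 2).div_const _)
      (fun m ω => by positivity) ?_
    refine Summable.of_nonneg_of_le (fun m => integral_nonneg fun ω => by positivity) (fun m => ?_)
      (((summable_nat_add_iff 1).2 (Real.summable_nat_pow_inv.2 one_lt_two)).mul_left C)
    rw [integral_div, div_le_iff₀ (by have := hcpos m; positivity)]
    refine (hvar (c m)).trans ?_
    rw [mul_assoc]
    refine mul_le_mul_of_nonneg_left ?_ hC
    have hbase : (1 : ℝ) ≤ (m + 1 : ℕ) := by simp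
    -- `(c m) ^ (1 / (1 + α))` dominates `(m + 1) ^ 2` by the choice of `q`.
    have h1 : ((m + 1 : ℕ) : ℝ) ^ 2 ≤ (c m : ℝ) ^ (1 / (1 + α)) := by
      simp only [hc]
      rw [Nat.cast_pow, ← Real.rpow_natCast _ q, ← Real.rpow_mul (by positivity),
        ← Real.rpow_natCast _ 2]
      refine Real.rpow_le_rpow_of_exponent_le hbase ?_
      rw [mul_one_div, le_div_iff₀ hp]
      simpa using hq2
    have h2 : (c m : ℝ) ^ (α / (1 + α)) * (c m : ℝ) ^ (1 / (1 + α)) = c m := by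
      rw [← Real.rpow_add (hcpos m), ← add_div, add_comm α, div_self hp.ne', Real.rpow_one]
    have h3 : (c m : ℝ) * (c m : ℝ) ^ (α / (1 + α)) * ((m + 1 : ℕ) : ℝ) ^ 2 ≤ (c m : ℝ) ^ 2 := by
      calc _ ≤ (c m : ℝ) * (c m : ℝ) ^ (α / (1 + α)) * (c m : ℝ) ^ (1 / (1 + α)) := by
            gcongr
        _ = _ := by rw [mul_assoc, h2, sq]
    rw [inv_mul_eq_div, le_div_iff₀ (by positivity)]
    exact h3
  filter_upwards [hsq] with ω hω
  refine tendsto_div_of_monotone_of_exists_subseq_tendsto_div _ 1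
    (isUnitStep_totalStake hN hS.disjoint ω).monotone_clock fun a ha => ⟨c, ?_, ?_, ?_⟩
  · have hratio : Tendsto (fun m : ℕ => (1 + 1 / ((m : ℝ) + 1)) ^ q) atTop (𝓝 1) := by
      simpa using (tendsto_one_div_add_atTop_nhds_zero_nat.const_add (1 : ℝ)).pow q
    filter_upwards [hratio.eventually_le_const ha] with m hm
    have h1 : (c (m + 1) : ℝ) = (1 + 1 / ((m : ℝ) + 1)) ^ q * c m := by
      simp only [hc]
      push_cast
      rw [← mul_pow]
      congr 1
      field_simp
    rw [h1]
    exact mul_le_mul_of_nonneg_right hm (hcpos m).le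
  · exact (tendsto_pow_atTop hq0).comp (tendsto_add_atTop_nat 1)
  · have h1 : Tendsto (fun m => clock α (fun s => totalStake n₀ S s ω) (c m) / c m - 1) atTop
        (𝓝 0) := by
      rw [tendsto_zero_iff_abs_tendsto_zero]
      have h2 := (Real.continuous_sqrt.tendsto 0).comp hω
      rw [Real.sqrt_zero] at h2
      refine h2.congr fun m => ?_
      rw [Function.comp_apply, ← div_pow, Real.sqrt_sq_eq_abs, sub_div, div_self (hcpos m).ne',
        Function.comp_apply]
    simpa using h1.add_const 1

/-! ### Measurability of the rescaled path -/

theorem continuous_uncurry_interp :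
    Continuous fun z : (ℕ → ℝ) × ℝ≥0 => interp z.1 z.2 := by
  have hlf : LocallyFinite fun m : ℕ =>
      {z : (ℕ → ℝ) × ℝ≥0 | (z.2 : ℝ) ∈ Set.Icc (m : ℝ) (m + 1)} := by
    intro z
    refine ⟨Prod.snd ⁻¹' Set.Iio (z.2 + 1), continuous_snd.continuousAt.preimage_mem_nhds
      (Iio_mem_nhds (by simp)), (Set.finite_Iic ⌈(z.2 : ℝ) + 1⌉₊).subset ?_⟩
    rintro m ⟨v, hv1, hv2⟩
    have h1 : (v.2 : ℝ) < z.2 + 1 := by exact_mod_cast hv2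
    have h2 : (m : ℝ) ≤ v.2 := hv1.1
    exact Set.mem_Iic.2 (by exact_mod_cast (h2.trans h1.le).trans (Nat.le_ceil ((z.2 : ℝ) + 1)))
  refine hlf.continuous ?_ (fun m => isClosed_Icc.preimage
    (NNReal.continuous_coe.comp continuous_snd)) fun m => ?_
  · exact Set.eq_univ_of_forall fun z => Set.mem_iUnion.2
      ⟨⌊(z.2 : ℝ)⌋₊, Nat.floor_le z.2.2, (Nat.lt_floor_add_one _).le⟩
  · have : Continuous fun z : (ℕ → ℝ) × ℝ≥0 =>
        z.1 m + ((z.2 : ℝ) - m) * (z.1 (m + 1) - z.1 m) := by fun_prop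
    exact this.continuousOn.congr fun z hz => interp_eq_of_mem z.1 m hz

/-- The rescaled path is a continuous function of the sequence `(N_t)` in `ℕ → ℝ`, whose Borel
σ-algebra is the product one. -/
theorem measurable_rescaledPath [MeasurableSpace Ω] (α : ℝ) {n₀ : Fin K → ℝ}
    {S : Fin K → ℕ → Set Ω} (hm : ∀ t, Measurable (totalStake n₀ S t)) (n : ℕ) :
    Measurable (rescaledPath α n₀ S n) := by
  have hcont : Continuous fun z : (ℕ → ℝ) × ℝ≥0 =>
      interp z.1 (n * z.2) / (n : ℝ) ^ (1 / (1 + α)) := by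
    have h := continuous_uncurry_interp.comp (continuous_fst.prodMk
      (continuous_const.mul continuous_snd) :
        Continuous fun z : (ℕ → ℝ) × ℝ≥0 => (z.1, (n : ℝ≥0) * z.2))
    simpa [Function.comp_def] using h.div_const ((n : ℝ) ^ (1 / (1 + α)))
  have hΦ := (ContinuousMap.curry ⟨_, hcont⟩).continuous
  exact hΦ.measurable.comp (measurable_pi_lambda (fun ω t => totalStake n₀ S t ω) hm)

/-! ### Convergence in distribution -/

/-- Almost sure convergence implies convergence in distribution, in a topological space that need
not be metric. -/
theorem tendstoInDistribution_of_ae_tendsto [MeasurableSpace Ω] {μ : Measure Ω}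
    [IsProbabilityMeasure μ] {E : Type*} [TopologicalSpace E] [MeasurableSpace E]
    [OpensMeasurableSpace E] {X : ℕ → Ω → E} {Z : Ω → E} (hX : ∀ n, AEMeasurable (X n) μ)
    (hZ : AEMeasurable Z μ) (h : ∀ᵐ ω ∂μ, Tendsto (fun n => X n ω) atTop (𝓝 (Z ω))) :
    TendstoInDistribution X atTop Z (fun _ => μ) μ where
  forall_aemeasurable := hX
  aemeasurable_limit := hZ
  tendsto := by
    refine ProbabilityMeasure.tendsto_iff_forall_integral_tendsto.2 fun f => ?_
    have hmap : ∀ Y : Ω → E, AEMeasurable Y μ → ∫ x, f x ∂(μ.map Y) = ∫ ω, f (Y ω) ∂μ :=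
      fun Y hY => integral_map hY f.continuous.measurable.aestronglyMeasurable
    simp only [ProbabilityMeasure.coe_mk, hmap _ (hX _), hmap _ hZ]
    refine tendsto_integral_of_dominated_convergence (fun _ => ‖f‖)
      (fun n => (f.continuous.measurable.comp_aemeasurable (hX n)).aestronglyMeasurable)
      (integrable_const _) (fun n => ae_of_all _ fun ω => f.norm_coe_le_norm _) ?_
    filter_upwards [h] with ω hω
    exact (f.continuous.tendsto _).comp hω

end PolyVoting
end

theorem proposition2p4 {Ω : Type*} [MeasurableSpace Ω] (μ : Measure Ω) [IsProbabilityMeasure μ]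
    (K : ℕ) (α : ℝ) (hα : 0 ≤ α) (n₀ : Fin K → ℝ) (hn₀ : ∀ k, 0 ≤ n₀ k) (hN : 0 < ∑ k, n₀ k)
    (S : Fin K → ℕ → Set Ω) (hS : PolyVoting.IsPolyVoting μ α n₀ S) :
    TendstoInDistribution (fun (n : ℕ) (ω : Ω) => PolyVoting.rescaledPath α n₀ S n ω) atTop
        (fun _ : Ω => PolyVoting.fluidPath α hα) (fun _ => μ) μ ∧
      PolyVoting.IsFluidSolution α (PolyVoting.fluid α) ∧
      ∀ Y : ℝ → ℝ, PolyVoting.IsFluidSolution α Y →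
        ∀ u, 0 ≤ u → Y u = PolyVoting.fluid α u := by
  refine ⟨?_, PolyVoting.isFluidSolution_fluid hα, fun Y hY u hu => hY.eq_fluid hα hu⟩
  refine PolyVoting.tendstoInDistribution_of_ae_tendsto
    (fun n => (PolyVoting.measurable_rescaledPath α (fun t =>
      (PolyVoting.measurable_totalStake n₀ S t).mono (hS.history_le t) le_rfl) n).aemeasurable)
    aemeasurable_const ?_
  filter_upwards [hS.ae_tendsto_clock_div hα hN] with ω hω
  have h := PolyVoting.isUnitStep_totalStake hN hS.disjoint ω
  exact PolyVoting.tendsto_rescaledPath hα h (h.tendsto_div_rpow hα hω)
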